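/- Let $\mathcal M$ be a finite-dimensional smooth Riemannian manifold without boundary, and let $R:T\mathcal M\to\mathcal M$ be a retraction, i.e. a $C^\infty$ map with $R_x(0_x)=x$ and $\frac{d}{dt}R_x(t\eta)|_{t=0}=\eta$ for all $x\in\mathcal M$, $\eta\in T_x\mathcal M$. Let $F=f+g$, where $f:\mathcal M\to\mathbb R$ is continuously differentiable and $g:\mathcal M\to\mathbb R$ is locally Lipschitz (equivalently, $g\circ R_x$ is locally Lipschitz on $T_x\mathcal M$ for every $x$). For a function $h$ on an inner product space $V$ put $h^\circ(\eta;v)=\limsup_{\xi\to\eta,\,t\downarrow0}\frac{h(\xi+tv)-h(\xi)}{t}$ and let $\partial h(\eta)=\{\zeta\in V:\langle\zeta,v\rangle\le h^\circ(\eta;v)\ \forall v\in V\}$ be the Clarke subdifferential. For $h:\mathcal M\to\mathbb R$ let $\partial h(x)=\partial(h\circ R_x)(0_x)$; a point $x$ is a stationary point of $F$ if $0\in\partial F(x)$. A function $h$ is $L$-retraction-smooth in $\mathcal N\subseteq\mathcal M$ if $h(R_x(\eta))\le h(x)+\langle\operatorname{grad}h(x),\eta\rangle_x+\frac L2\|\eta\|_x^2$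 whenever $x\in\mathcal N$, $\eta\in T_x\mathcal M$ and $R_x(\eta)\in\mathcal N$. Let $\tilde L>0$, let $q:\mathbb R^2\to\mathbb R$ be continuous, let $\varepsilon_k>0$, and let $\{x_k\}$ be generated by the inexact Riemannian proximal gradient method: with $\ell_x(\eta)=\langle\operatorname{grad}f(x),\eta\rangle_x+\frac{\tilde L}2\|\eta\|_x^2+g(R_x(\eta))$, for every $k\ge0$ there are $\hat\eta_k,\eta_k^*\in T_{x_k}\mathcal M$ such that $0\in\partial\ell_{x_k}(\eta_k^*)$, $$\|\hat\eta_k-\eta_k^*\|\le q(\varepsilon_k,\|\hat\eta_k\|),\qquad \ell_{x_k}(\hat\eta_k)\le\ell_{x_k}(0),\qquad x_{k+1}=R_{x_k}(\hat\eta_k).$$ Assume that $F$ is bounded from below, that the sublevel set $\Omega_{x_0}=\{x\in\mathcal M: F(x)\le F(x_0)\}$ is compact, that $f$ is $L$-retraction-smooth in a set $\mathcal N\supseteq\Omega_{x_0}$ that contains all the iterates $x_k$ (for instance $\mathcal N=\mathcal M$, or $\mathcal N=\Omega_{x_0}$ if the iterates stay in $\Omega_{x_0}$), that $\tilde L>L$,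 and that $\lim_{k\to\infty}q(\varepsilon_k,\|\hat\eta_k\|)=0$. Then $\{x_k\}$ has at least one accumulation point. If $x_*$ is any accumulation point of $\{x_k\}$, then $x_*$ is a stationary point of $F$; moreover, with $\beta=(\tilde L-L)/2$, for every $\epsilon>0$ there is an index $k\le (F(x_0)-F(x_*))/(\beta\epsilon^2)$ such that $\|\hat\eta_k\|\le\epsilon$. -/

import Mathlib

open Set Filter Topology
open scoped Manifold ContDiff Bundle

noncomputable section

namespace IRPG

section Clarke

variable {V : Type*} [NormedAddCommGroup V] [InnerProductSpace ℝ V]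

/-- Clarke generalized directional derivative
`h°(η; v) = limsup_{ξ → η, t ↓ 0} (h (ξ + t v) - h ξ) / t`. The upper limit is taken in the extended
reals, so that it always exists; it is a real number when `h` is Lipschitz near `η`. -/
def clarkeDeriv (h : V → ℝ) (η v : V) : EReal :=
  limsup (fun p : V × ℝ => (((h (p.1 + p.2 • v) - h p.1) / p.2 : ℝ) : EReal))
    (𝓝 η ×ˢ 𝓝[>] (0 : ℝ))

/-- Clarke generalized subdifferential of a function on an inner product space. -/
def clarkeSubdiff (h : V → ℝ) (η : V) : Set V :=
  {ζ | ∀ v : V, ((inner ℝ ζ v : ℝ) : EReal) ≤ clarkeDeriv h η v}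

end Clarke

section Manifold

variable (E : Type*) [NormedAddCommGroup E] [NormedSpace ℝ E]
  (M : Type*) [TopologicalSpace M] [ChartedSpace E M] [IsManifold 𝓘(ℝ, E) ∞ M]

/-- A (globally defined) retraction on `M`: a smooth map `R : TM → M` with `R(0_x) = x` and
`d/dt R(t η)|_{t = 0} = η` for all `η ∈ T_x M`. -/
structure Retraction where
  /-- The underlying map on the tangent bundle. -/
  toFun : TangentBundle 𝓘(ℝ, E) M → M
  contMDiff_toFun : ContMDiff 𝓘(ℝ, E).tangent 𝓘(ℝ, E) ∞ toFun
  map_zero : ∀ x : M, toFun ⟨x, 0⟩ = x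
  hasMFDerivAt_ray : ∀ (x : M) (η : TangentSpace 𝓘(ℝ, E) x),
    HasMFDerivAt 𝓘(ℝ, ℝ) 𝓘(ℝ, E) (fun t : ℝ => toFun ⟨x, t • η⟩) 0
      (ContinuousLinearMap.toSpanSingleton ℝ (show E from η))

variable {E M}

/-- The restriction `R_x` of a retraction to `T_x M`. -/
def Retraction.at (R : Retraction E M) (x : M) (η : TangentSpace 𝓘(ℝ, E) x) : M :=
  R.toFun ⟨x, η⟩

variable [FiniteDimensional ℝ E] [Bundle.RiemannianBundle (fun x : M => TangentSpace 𝓘(ℝ, E) x)]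

/-- The Riemannian gradient: the Riesz representative of the differential with respect to the
Riemannian metric. -/
def grad (h : M → ℝ) (x : M) : TangentSpace 𝓘(ℝ, E) x :=
  haveI : FiniteDimensional ℝ (TangentSpace 𝓘(ℝ, E) x) := inferInstanceAs (FiniteDimensional ℝ E)
  haveI : CompleteSpace (TangentSpace 𝓘(ℝ, E) x) := FiniteDimensional.complete ℝ _
  (InnerProductSpace.toDual ℝ (TangentSpace 𝓘(ℝ, E) x)).symm (mfderiv 𝓘(ℝ, E) 𝓘(ℝ, ℝ) h x)

theorem inner_grad (h : M → ℝ) (x : M) (η : TangentSpace 𝓘(ℝ, E) x) :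
    inner ℝ (grad h x) η = mfderiv 𝓘(ℝ, E) 𝓘(ℝ, ℝ) h x η := by
  have : FiniteDimensional ℝ (TangentSpace 𝓘(ℝ, E) x) := inferInstanceAs (FiniteDimensional ℝ E)
  have : CompleteSpace (TangentSpace 𝓘(ℝ, E) x) := FiniteDimensional.complete ℝ _
  exact InnerProductSpace.toDual_symm_apply

/-- `h` is `L`-retraction-smooth with respect to `R` in `N`. -/
def RetractionSmoothOn (R : Retraction E M) (L : ℝ) (h : M → ℝ) (N : Set M) : Prop :=
  ∀ x ∈ N, ∀ S : Set (TangentSpace 𝓘(ℝ, E) x), MapsTo (R.at x) S N →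
    ∀ η ∈ S, h (R.at x η) ≤ h x + inner ℝ (grad h x) η + L / 2 * ‖η‖ ^ 2

/-- `h` is locally Lipschitz: every pullback `h ∘ R_x` is locally Lipschitz on `T_x M`.
As `R_x` is smooth and a diffeomorphism near `0_x`, this is local Lipschitz continuity on `M`. -/
def RetractionLocallyLipschitz (R : Retraction E M) (h : M → ℝ) : Prop :=
  ∀ x : M, LocallyLipschitz (fun η : TangentSpace 𝓘(ℝ, E) x => h (R.at x η))

/-- The Riemannian generalized subdifferential `∂h(x) = ∂(h ∘ R_x)(0_x)`. -/
def riemannianSubdiff (R : Retraction E M) (h : M → ℝ) (x : M) : Set (TangentSpace 𝓘(ℝ, E) x) :=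
  clarkeSubdiff (fun η : TangentSpace 𝓘(ℝ, E) x => h (R.at x η)) 0

/-- `x` is a stationary point of `h`: `0 ∈ ∂h(x)`. -/
def IsStationaryPoint (R : Retraction E M) (h : M → ℝ) (x : M) : Prop :=
  (0 : TangentSpace 𝓘(ℝ, E) x) ∈ riemannianSubdiff R h x

/-- The objective
`ℓ_x(η) = ⟨grad f(x), η⟩ + (Lt / 2) ‖η‖² + g(R_x(η))` of the Riemannian proximal mapping. -/
def proxModel (R : Retraction E M) (f g : M → ℝ) (Lt : ℝ) (x : M)
    (η : TangentSpace 𝓘(ℝ, E) x) : ℝ :=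
  inner ℝ (grad f x) η + Lt / 2 * ‖η‖ ^ 2 + g (R.at x η)

/-- `x 0, x 1, …` are the iterates of a run of the inexact Riemannian proximal gradient method for
`f + g`, with parameter `Lt`, tolerances `ε k`, accuracy function `q`, search directions `ηhat k`,
and `ηstar k` the stationary point of the proximal objective at `x k` that `ηhat k` approximates. -/
structure IsIRPGRun (R : Retraction E M) (f g : M → ℝ) (Lt : ℝ) (q : ℝ × ℝ → ℝ) (ε : ℕ → ℝ)
    (x : ℕ → M) (ηhat ηstar : ∀ k, TangentSpace 𝓘(ℝ, E) (x k)) : Prop where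
  Lt_pos : 0 < Lt
  continuous_q : Continuous q
  ε_pos : ∀ k, 0 < ε k
  stationary : ∀ k, 0 ∈ clarkeSubdiff (proxModel R f g Lt (x k)) (ηstar k)
  accuracy : ∀ k, ‖ηhat k - ηstar k‖ ≤ q (ε k, ‖ηhat k‖)
  descent : ∀ k, proxModel R f g Lt (x k) (ηhat k) ≤ proxModel R f g Lt (x k) 0
  update : ∀ k, x (k + 1) = R.at (x k) (ηhat k)

end Manifold

end IRPG

end

/-!
Write `F = f + g`. The model decrease `ℓ_{x_k}(η̂_k) ≤ ℓ_{x_k}(0)` together with retraction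
smoothness gives `F(x_{k+1}) + (L̃ - L)/2 ‖η̂_k‖² ≤ F(x_k)`; telescoping above the value of `F` at
an accumulation point gives the complexity bound and `‖η̂_k‖ → 0`, hence `‖η*_k‖ → 0`.

The difficulty in passing to the limit in `0 ∈ ∂ℓ_{x_k}(η*_k)` is that the tangent spaces vary.
It is met by testing Clarke stationarity along vector fields `W` on `M`: for all `r > 0`,
`ℓ_y(ξ + t W(y)) - ℓ_y(ξ) ≥ -r t` for `y = x_k`, some `ξ` arbitrarily close to `η*_k` and some
arbitrarily small `t > 0`. As `(x_k, η*_k)` accumulates at the zero vector `0_{x_*}` of `TM`, such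
`(y, ξ)` exist arbitrarily close to `0_{x_*}`. There the following two replacements cost only `o(t)`
and hence preserve the property.

* The increment of `ℓ_y` may be replaced by that of `F ∘ R`: `f ∘ R` is continuously
  differentiable and the quadratic term of `ℓ_y` has slope `L̃ ⟨ξ, W(y)⟩ → 0`.
* The increment of `F ∘ R` over `T_y M` may be replaced by that of `F ∘ R_{x_*}` over `T_{x_*} M`
  at `ζ = R_{x_*}⁻¹(R_y(ξ))` in the direction `W(x_*)`: `R_{x_*}⁻¹ ∘ R` is smooth with fibre
  derivative the identity at `0_{x_*}`, and `F ∘ R_{x_*}` is Lipschitz near `0`.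
-/

namespace IRPG

section Clarke

variable {V : Type*} [NormedAddCommGroup V] [InnerProductSpace ℝ V]

theorem zero_le_clarkeDeriv_iff {h : V → ℝ} {η v : V} :
    0 ≤ clarkeDeriv h η v ↔ ∀ r : ℝ, 0 < r →
      ∃ᶠ p : V × ℝ in 𝓝 η ×ˢ 𝓝[>] (0 : ℝ), -(r * p.2) ≤ h (p.1 + p.2 • v) - h p.1 := by
  have hpos : ∀ᶠ p : V × ℝ in 𝓝 η ×ˢ 𝓝[>] (0 : ℝ), 0 < p.2 :=
    tendsto_snd.eventually self_mem_nhdsWithin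
  rw [clarkeDeriv, le_limsup_iff']
  constructor
  · intro hlim r hr
    have hfreq := hlim ((-r : ℝ) : EReal) (by exact_mod_cast neg_neg_of_pos hr)
    refine (hfreq.and_eventually hpos).mono fun p ⟨hp, ht⟩ => ?_
    rwa [EReal.coe_le_coe_iff, le_div_iff₀ ht, neg_mul] at hp
  · intro hfreq y hy
    obtain ⟨z, hyz, hz⟩ := EReal.lt_iff_exists_real_btwn.1 hy
    have hz' : 0 < -z := by exact_mod_cast neg_pos.2 (EReal.coe_neg'.1 hz)
    refine ((hfreq (-z) hz').and_eventually hpos).mono fun p ⟨hp, ht⟩ => hyz.le.trans ?_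
    rwa [EReal.coe_le_coe_iff, le_div_iff₀ ht, ← neg_neg z, neg_mul]

theorem zero_mem_clarkeSubdiff_iff {h : V → ℝ} {η : V} :
    0 ∈ clarkeSubdiff h η ↔ ∀ v : V, ∀ r : ℝ, 0 < r →
      ∃ᶠ p : V × ℝ in 𝓝 η ×ˢ 𝓝[>] (0 : ℝ), -(r * p.2) ≤ h (p.1 + p.2 • v) - h p.1 := by
  simp only [clarkeSubdiff, mem_ofPred_eq, inner_zero_left, EReal.coe_zero, zero_le_clarkeDeriv_iff]

end Clarke

section Asymptotics

variable {α E F : Type*} [NormedAddCommGroup E] [NormedAddCommGroup F] {l : Filter α}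

theorem isLittleO_comp_sub_comp_of_lipschitzOnWith {G : Type*} [NormedAddCommGroup G] {H : E → F}
    {K : NNReal} {s : Set E} {a : E} {u v : α → E} {τ : α → G} (hH : LipschitzOnWith K H s)
    (hs : s ∈ 𝓝 a) (hu : Tendsto u l (𝓝 a)) (hv : Tendsto v l (𝓝 a))
    (huv : (fun p => u p - v p) =o[l] τ) : (fun p => H (u p) - H (v p)) =o[l] τ := by
  refine Asymptotics.IsBigO.trans_isLittleO (.of_bound K ?_) huv
  filter_upwards [hu hs, hv hs] with p hup hvp
  simpa only [dist_eq_norm] using hH.dist_le_mul _ hup _ hvp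

theorem isLittleO_add_smul_of_hasStrictFDerivAt [NormedSpace ℝ E] [NormedSpace ℝ F] {T : E → F}
    {T' : E →L[ℝ] F} {a w₀ : E} {z w : α → E} {τ : α → ℝ} (hT : HasStrictFDerivAt T T' a)
    (hz : Tendsto z l (𝓝 a)) (hw : Tendsto w l (𝓝 w₀)) (hτ : Tendsto τ l (𝓝 0)) :
    (fun p => T (z p + τ p • w p) - T (z p) - τ p • T' w₀) =o[l] τ := by
  have hz' : Tendsto (fun p => z p + τ p • w p) l (𝓝 a) := by
    simpa using hz.add (hτ.smul hw)
  have hstep : (fun p => τ p • w p) =O[l] τ := by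
    simpa using (Asymptotics.isBigO_refl τ l).smul (hw.isBigO_one ℝ)
  have hstrict : (fun p => T (z p + τ p • w p) - T (z p) - T' (τ p • w p)) =o[l] τ := by
    have := hT.isLittleO.comp_tendsto (hz'.prodMk_nhds hz)
    simp only [Function.comp_def, add_sub_cancel_left] at this
    exact this.trans_isBigO hstep
  have hlin : (fun p => τ p • (T' (w p) - T' w₀)) =o[l] τ := by
    have hzero : Tendsto (fun p => T' (w p) - T' w₀) l (𝓝 0) := by
      simpa using ((T'.continuous.tendsto w₀).comp hw).sub_const (T' w₀)
    simpa using (Asymptotics.isBigO_refl τ l).smul_isLittleO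
      ((Asymptotics.isLittleO_one_iff ℝ).2 hzero)
  refine (hstrict.add hlin).congr_left fun p => ?_
  rw [map_smul, smul_sub]
  abel

theorem frequently_neg_mul_le_of_isLittleO {A B τ : α → ℝ} (hτ : ∀ᶠ p in l, 0 < τ p)
    (hAB : (fun p => A p - B p) =o[l] τ) (hA : ∀ r > 0, ∃ᶠ p in l, -(r * τ p) ≤ A p)
    {r : ℝ} (hr : 0 < r) : ∃ᶠ p in l, -(r * τ p) ≤ B p := by
  refine ((hA (r / 2) (half_pos hr)).and_eventually
    (hτ.and (hAB.def (half_pos hr)))).mono fun p ⟨hAp, hτp, herr⟩ => ?_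
  rw [Real.norm_of_nonneg hτp.le] at herr
  linarith [hAp, le_of_abs_le herr]

end Asymptotics

section ClusterPoints

variable {X Y Z : Type*} [TopologicalSpace X]

theorem frequently_nhds_prod_of_mapClusterPt {F : Filter Y} {u : Y → X} {a : X} {l : Filter Z}
    {p : X × Z → Prop} (ha : MapClusterPt a F u) (hp : ∀ y, ∃ᶠ P in 𝓝 (u y) ×ˢ l, p P) :
    ∃ᶠ P in 𝓝 a ×ˢ l, p P := by
  intro hnot
  obtain ⟨pa, hpa, pb, hpb, hprod⟩ := eventually_prod_iff.1 hnot
  obtain ⟨y, hy⟩ := (ha.frequently hpa.eventually_nhds).exists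
  exact hp y ((hy.prod_mk hpb).mono fun _ h => hprod h.1 h.2)

theorem le_of_antitone_of_mapClusterPt {ι : Type*} [Preorder ι] [TopologicalSpace Y] [LinearOrder Y]
    [ClosedIicTopology Y] {F : X → Y} {x : ι → X} {a : X} (hF : ContinuousAt F a)
    (hanti : Antitone fun k => F (x k)) (ha : MapClusterPt a atTop x) (k : ι) : F a ≤ F (x k) := by
  by_contra! hlt
  obtain ⟨j, hj, hkj⟩ :=
    ((ha.frequently (hF.eventually_const_lt hlt)).and_eventually (eventually_ge_atTop k)).exists
  exact (hanti hkj).not_gt hj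

end ClusterPoints

section TangentBundle

variable {E : Type*} [NormedAddCommGroup E] [NormedSpace ℝ E]
  {M : Type*} [TopologicalSpace M] [ChartedSpace E M] [IsManifold 𝓘(ℝ, E) ∞ M]

/-- The translation `(ξ, t) ↦ ξ + t W(y)`, `ξ ∈ T_y M`, within the fibres of the tangent bundle,
along a vector field `W`. -/
noncomputable def fiberShift (W : ∀ y : M, TangentSpace 𝓘(ℝ, E) y)
    (P : TangentBundle 𝓘(ℝ, E) M × ℝ) : TangentBundle 𝓘(ℝ, E) M :=
  ⟨P.1.proj, P.1.2 + P.2 • W P.1.proj⟩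

variable (E) in
/-- The filter along which the Clarke difference quotients of maps on `TM` at the zero vector
`0_{x₀}` are formed: tangent vectors, with variable base point, tend to `0_{x₀}` and `t ↓ 0`. -/
noncomputable def zeroVectorFilter (x₀ : M) : Filter (TangentBundle 𝓘(ℝ, E) M × ℝ) :=
  𝓝 ⟨x₀, 0⟩ ×ˢ 𝓝[>] 0

variable {W : ∀ y : M, TangentSpace 𝓘(ℝ, E) y} {x₀ : M}

theorem tendsto_fst_zeroVectorFilter :
    Tendsto Prod.fst (zeroVectorFilter E x₀) (𝓝 ⟨x₀, 0⟩) :=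
  tendsto_fst

theorem tendsto_snd_zeroVectorFilter :
    Tendsto Prod.snd (zeroVectorFilter E x₀) (𝓝[>] 0) :=
  tendsto_snd

theorem tendsto_proj_zeroVectorFilter :
    Tendsto (fun P => P.1.proj) (zeroVectorFilter E x₀) (𝓝 x₀) :=
  ((FiberBundle.continuous_proj E (TangentSpace 𝓘(ℝ, E))).tendsto _).comp
    tendsto_fst_zeroVectorFilter

theorem eventually_snd_pos_zeroVectorFilter : ∀ᶠ P in zeroVectorFilter E x₀, 0 < P.2 :=
  tendsto_snd_zeroVectorFilter.eventually self_mem_nhdsWithin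

/-- The fibre coordinate of a tangent vector in the trivialization of `TM` at `x₀`. -/
noncomputable def fiberCoord (x₀ : M) (p : TangentBundle 𝓘(ℝ, E) M) : E :=
  (trivializationAt E (TangentSpace 𝓘(ℝ, E)) x₀ p).2

theorem fiberCoord_mk {y : M} (hy : y ∈ (chartAt E x₀).source) (ξ : TangentSpace 𝓘(ℝ, E) y) :
    fiberCoord x₀ ⟨y, ξ⟩ =
      (trivializationAt E (TangentSpace 𝓘(ℝ, E)) x₀).continuousLinearMapAt ℝ y ξ :=
  (Bundle.Trivialization.continuousLinearMapAt_apply_of_mem ℝ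
    (trivializationAt E (TangentSpace 𝓘(ℝ, E)) x₀) hy ξ).symm

theorem fiberCoord_zero (x₀ : M) : fiberCoord x₀ (⟨x₀, 0⟩ : TangentBundle 𝓘(ℝ, E) M) = 0 := by
  rw [fiberCoord_mk (mem_chart_source E x₀)]
  exact map_zero _

theorem tendsto_nhds_zeroVector_iff {α : Type*} {l : Filter α} {u : α → TangentBundle 𝓘(ℝ, E) M} :
    Tendsto u l (𝓝 ⟨x₀, 0⟩) ↔
      Tendsto (fun a => (u a).proj) l (𝓝 x₀) ∧ Tendsto (fun a => fiberCoord x₀ (u a)) l (𝓝 0) := by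
  rw [← fiberCoord_zero x₀]
  have hz : (⟨x₀, 0⟩ : TangentBundle 𝓘(ℝ, E) M) ∈
      (trivializationAt E (TangentSpace 𝓘(ℝ, E)) x₀).source :=
    (trivializationAt E (TangentSpace 𝓘(ℝ, E)) x₀).mem_source.2 (mem_chart_source E x₀)
  exact (trivializationAt E (TangentSpace 𝓘(ℝ, E)) x₀).tendsto_nhds_iff (f := u) hz

theorem tendsto_fiberCoord_section
    (hW : ContinuousAt (fun y => (⟨y, W y⟩ : TangentBundle 𝓘(ℝ, E) M)) x₀) :
    Tendsto (fun y => fiberCoord x₀ ⟨y, W y⟩) (𝓝 x₀) (𝓝 (fiberCoord x₀ ⟨x₀, W x₀⟩)) :=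
  ((FiberBundle.continuousAt_totalSpace E _).1 hW).2

theorem fiberCoord_fiberShift {P : TangentBundle 𝓘(ℝ, E) M × ℝ}
    (hP : P.1.proj ∈ (chartAt E x₀).source) :
    fiberCoord x₀ (fiberShift W P) =
      fiberCoord x₀ P.1 + P.2 • fiberCoord x₀ ⟨P.1.proj, W P.1.proj⟩ := by
  obtain ⟨⟨y, ξ⟩, t⟩ := P
  simp only [fiberShift, fiberCoord_mk hP, map_add, map_smul]

theorem extChartAt_tangent_apply {p : TangentBundle 𝓘(ℝ, E) M}
    (hp : p.proj ∈ (chartAt E x₀).source) :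
    extChartAt 𝓘(ℝ, E).tangent (⟨x₀, 0⟩ : TangentBundle 𝓘(ℝ, E) M) p =
      (extChartAt 𝓘(ℝ, E) x₀ p.proj, fiberCoord x₀ p) := by
  rw [FiberBundle.extChartAt]
  ext1
  · exact congrArg (extChartAt 𝓘(ℝ, E) x₀)
      ((trivializationAt E (TangentSpace 𝓘(ℝ, E)) x₀).coe_fst' hp)
  · rfl

theorem extChartAt_tangent_fiberShift {P : TangentBundle 𝓘(ℝ, E) M × ℝ}
    (hP : P.1.proj ∈ (chartAt E x₀).source) :
    extChartAt 𝓘(ℝ, E).tangent (⟨x₀, 0⟩ : TangentBundle 𝓘(ℝ, E) M) (fiberShift W P) =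
      extChartAt 𝓘(ℝ, E).tangent (⟨x₀, 0⟩ : TangentBundle 𝓘(ℝ, E) M) P.1 +
        P.2 • ((0 : E), fiberCoord x₀ ⟨P.1.proj, W P.1.proj⟩) := by
  rw [extChartAt_tangent_apply (p := fiberShift W P) hP, extChartAt_tangent_apply hP,
    fiberCoord_fiberShift hP]
  simp [fiberShift]

theorem eventually_proj_mem_source :
    ∀ᶠ P in zeroVectorFilter E x₀, P.1.proj ∈ (chartAt E x₀).source :=
  tendsto_proj_zeroVectorFilter (chart_source_mem_nhds E x₀)

theorem tendsto_fiberShift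
    (hW : ContinuousAt (fun y => (⟨y, W y⟩ : TangentBundle 𝓘(ℝ, E) M)) x₀) :
    Tendsto (fiberShift W) (zeroVectorFilter E x₀) (𝓝 ⟨x₀, 0⟩) := by
  refine tendsto_nhds_zeroVector_iff.2 ⟨tendsto_proj_zeroVectorFilter, ?_⟩
  have hsum := (tendsto_nhds_zeroVector_iff.1 tendsto_fst_zeroVectorFilter).2.add
    ((tendsto_snd_zeroVectorFilter.mono_right nhdsWithin_le_nhds).smul
      ((tendsto_fiberCoord_section hW).comp tendsto_proj_zeroVectorFilter))
  rw [zero_smul, add_zero] at hsum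
  refine hsum.congr' ?_
  filter_upwards [eventually_proj_mem_source] with P hP
  exact (fiberCoord_fiberShift hP).symm

theorem isLittleO_fiberShift {F : Type*} [NormedAddCommGroup F] [NormedSpace ℝ F]
    {S : TangentBundle 𝓘(ℝ, E) M → F} {s' : F}
    (hS : ContMDiffAt 𝓘(ℝ, E).tangent 𝓘(ℝ, F) 1 S ⟨x₀, 0⟩)
    (hs' : HasDerivAt (fun t : ℝ => S ⟨x₀, t • W x₀⟩) s' 0)
    (hW : ContinuousAt (fun y => (⟨y, W y⟩ : TangentBundle 𝓘(ℝ, E) M)) x₀) :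
    (fun P => S (fiberShift W P) - S P.1 - P.2 • s') =o[zeroVectorFilter E x₀] Prod.snd := by
  set z : TangentBundle 𝓘(ℝ, E) M := ⟨x₀, 0⟩
  set κ := extChartAt 𝓘(ℝ, E).tangent z
  have hT : HasStrictFDerivAt (S ∘ κ.symm) (fderiv ℝ (S ∘ κ.symm) (κ z)) (κ z) := by
    have hκ := (contMDiffOn_extChartAt_symm (I := 𝓘(ℝ, E).tangent) (n := 1) z).contMDiffAt
      (extChartAt_target_mem_nhds z)
    exact (hS.comp_of_eq hκ (extChartAt_to_inv z)).contDiffAt.hasStrictFDerivAt one_ne_zero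
  have hleft {p : TangentBundle 𝓘(ℝ, E) M} (hp : p.proj ∈ (chartAt E x₀).source) :
      (S ∘ κ.symm) (κ p) = S p := by
    refine congrArg S (κ.left_inv ?_)
    rwa [extChartAt_source, TangentBundle.mem_chart_source_iff]
  have hderiv : fderiv ℝ (S ∘ κ.symm) (κ z) (0, fiberCoord x₀ ⟨x₀, W x₀⟩) = s' := by
    refine (hT.hasFDerivAt.hasLineDerivAt _).unique
      (hs'.congr_of_eventuallyEq (.of_forall fun t => ?_))
    have hline := extChartAt_tangent_fiberShift (W := W) (P := (z, t)) (mem_chart_source E x₀)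
    dsimp only [z] at hline ⊢
    rw [← hline, hleft (p := fiberShift W (⟨x₀, 0⟩, t)) (mem_chart_source E x₀), fiberShift,
      zero_add]
  have hexp := isLittleO_add_smul_of_hasStrictFDerivAt hT
    ((continuousAt_extChartAt (I := 𝓘(ℝ, E).tangent) z).tendsto.comp
      tendsto_fst_zeroVectorFilter)
    (((tendsto_const_nhds (x := (0 : E))).prodMk_nhds (tendsto_fiberCoord_section hW)).comp
      tendsto_proj_zeroVectorFilter)
    (tendsto_snd_zeroVectorFilter.mono_right nhdsWithin_le_nhds)
  rw [hderiv] at hexp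
  refine hexp.congr' ?_ .rfl
  filter_upwards [eventually_proj_mem_source] with P hP
  rw [← hleft hP, ← hleft (p := fiberShift W P) hP, extChartAt_tangent_fiberShift hP]
  rfl

end TangentBundle

section Retraction

variable {E : Type*} [NormedAddCommGroup E] [NormedSpace ℝ E]
  {M : Type*} [TopologicalSpace M] [ChartedSpace E M] [IsManifold 𝓘(ℝ, E) ∞ M]

theorem Retraction.at_zero (R : Retraction E M) (x : M) : R.at x 0 = x := R.map_zero x

theorem contMDiff_totalSpaceMk (x₀ : M) :
    ContMDiff 𝓘(ℝ, E) 𝓘(ℝ, E).tangent ∞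
      (fun u : E => (⟨x₀, u⟩ : TangentBundle 𝓘(ℝ, E) M)) := by
  intro u
  let e : E →L[ℝ] E :=
    (trivializationAt E (TangentSpace 𝓘(ℝ, E)) x₀).continuousLinearMapAt ℝ x₀
  exact Bundle.contMDiffAt_totalSpace.2 ⟨contMDiffAt_const,
    e.contMDiff.contMDiffAt.congr_of_eventuallyEq
      (.of_forall fun ξ => fiberCoord_mk (mem_chart_source E x₀) ξ)⟩

variable (R : Retraction E M) (x₀ : M)

theorem Retraction.hasDerivAt_ray (η : TangentSpace 𝓘(ℝ, E) x₀) :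
    HasDerivAt (F := E) (fun t : ℝ => extChartAt 𝓘(ℝ, E) x₀ (R.at x₀ (t • η))) η 0 := by
  have hderiv := (R.hasMFDerivAt_ray x₀ η).2
  have hbase : R.toFun ⟨x₀, (0 : ℝ) • η⟩ = x₀ := by rw [zero_smul, R.map_zero]
  rw [writtenInExtChartAt, hbase] at hderiv
  simp only [modelWithCornersSelf_coe, range_id] at hderiv
  exact hasFDerivWithinAt_univ.1 hderiv

theorem Retraction.tendsto_at_zero : Tendsto (fun u : E => R.at x₀ u) (𝓝 0) (𝓝 x₀) :=
  ((R.contMDiff_toFun.comp (contMDiff_totalSpaceMk x₀)).continuous.tendsto 0).mono_right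
    (congrArg 𝓝 (R.at_zero x₀)).le

theorem Retraction.contDiffAt_extChartAt_at :
    ContDiffAt ℝ ∞ (fun u : E => extChartAt 𝓘(ℝ, E) x₀ (R.at x₀ u)) 0 :=
  (ContMDiffAt.comp_of_eq (g := extChartAt 𝓘(ℝ, E) x₀) contMDiffAt_extChartAt
    (R.contMDiff_toFun.comp (contMDiff_totalSpaceMk x₀)).contMDiffAt (R.at_zero x₀)).contDiffAt

theorem Retraction.hasFDerivAt_extChartAt_at :
    HasFDerivAt (fun u : E => extChartAt 𝓘(ℝ, E) x₀ (R.at x₀ u))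
      (ContinuousLinearEquiv.refl ℝ E : E →L[ℝ] E) 0 := by
  have hd := ((R.contDiffAt_extChartAt_at x₀).differentiableAt (by simp)).hasFDerivAt
  refine hd.congr_fderiv (ContinuousLinearMap.ext fun u => ?_)
  refine (hd.hasLineDerivAt u).unique ((R.hasDerivAt_ray x₀ u).congr_of_eventuallyEq
    (.of_forall fun t => ?_))
  simp only [zero_add]
  rfl

theorem Retraction.exists_localLog [CompleteSpace E] :
    ∃ Log : M → E, ContMDiffAt 𝓘(ℝ, E) 𝓘(ℝ, E) ∞ Log x₀ ∧ Log x₀ = 0 ∧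
      (∀ᶠ u : E in 𝓝 0, Log (R.at x₀ u) = u) ∧ ∀ᶠ y in 𝓝 x₀, R.at x₀ (Log y) = y := by
  have hθ := R.contDiffAt_extChartAt_at x₀
  have hθ' := R.hasFDerivAt_extChartAt_at x₀
  have hstrict := hθ.hasStrictFDerivAt' hθ' (by simp)
  have hbase : extChartAt 𝓘(ℝ, E) x₀ (R.at x₀ (0 : E)) = extChartAt 𝓘(ℝ, E) x₀ x₀ :=
    congrArg _ (R.at_zero x₀)
  set inv := hθ.localInverse hθ' (by simp)
  have hinv₀ : inv (extChartAt 𝓘(ℝ, E) x₀ x₀) = 0 :=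
    hbase ▸ hθ.localInverse_apply_image hθ' (by simp)
  have hlog : ContMDiffAt 𝓘(ℝ, E) 𝓘(ℝ, E) ∞ (inv ∘ extChartAt 𝓘(ℝ, E) x₀) x₀ :=
    ContMDiffAt.comp x₀ (hbase ▸ hθ.to_localInverse hθ' (by simp)).contMDiffAt
      contMDiffAt_extChartAt
  refine ⟨_, hlog, hinv₀, hstrict.eventually_left_inverse, ?_⟩
  have hright := hstrict.eventually_right_inverse
  rw [hbase] at hright
  have hat : Tendsto (fun y => R.at x₀ (inv (extChartAt 𝓘(ℝ, E) x₀ y))) (𝓝 x₀) (𝓝 x₀) :=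
    (R.tendsto_at_zero x₀).comp (hinv₀ ▸ hlog.continuousAt.tendsto)
  filter_upwards [(continuousAt_extChartAt (I := 𝓘(ℝ, E)) x₀).eventually hright,
    hat (extChartAt_source_mem_nhds (I := 𝓘(ℝ, E)) x₀),
    extChartAt_source_mem_nhds (I := 𝓘(ℝ, E)) x₀]
    with y hy hy' hys
  exact (extChartAt 𝓘(ℝ, E) x₀).injOn hy' hys hy

end Retraction

section Expansion

variable {E : Type*} [NormedAddCommGroup E] [NormedSpace ℝ E]
  {M : Type*} [TopologicalSpace M] [ChartedSpace E M] [IsManifold 𝓘(ℝ, E) ∞ M]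
  {F : Type*} [NormedAddCommGroup F] [NormedSpace ℝ F]
  (R : Retraction E M) {x₀ : M} {W : ∀ y : M, TangentSpace 𝓘(ℝ, E) y}

theorem Retraction.hasDerivAt_comp_ray {h : M → F} {h' : E →L[ℝ] F}
    (hh : HasMFDerivAt 𝓘(ℝ, E) 𝓘(ℝ, F) h x₀ h') (η : TangentSpace 𝓘(ℝ, E) x₀) :
    HasDerivAt (fun t : ℝ => h (R.at x₀ (t • η))) (h' η) 0 := by
  have hbase : R.toFun ⟨x₀, (0 : ℝ) • η⟩ = x₀ := by rw [zero_smul, R.map_zero]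
  rw [← hbase] at hh
  have hcomp := hh.comp (0 : ℝ) (R.hasMFDerivAt_ray x₀ η)
  have hfderiv : HasFDerivAt (fun t : ℝ => h (R.at x₀ (t • η)))
      (h' ∘L ContinuousLinearMap.toSpanSingleton ℝ (show E from η)) 0 :=
    hasMFDerivAt_iff_hasFDerivAt.1 hcomp
  exact hfderiv.hasDerivAt.congr_deriv (congrArg h' (one_smul ℝ (show E from η)))

theorem Retraction.isLittleO_comp_fiberShift {h : M → F} {h' : E →L[ℝ] F}
    (hh : ContMDiffAt 𝓘(ℝ, E) 𝓘(ℝ, F) 1 h x₀) (hh' : HasMFDerivAt 𝓘(ℝ, E) 𝓘(ℝ, F) h x₀ h')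
    (hW : ContinuousAt (fun y => (⟨y, W y⟩ : TangentBundle 𝓘(ℝ, E) M)) x₀) :
    (fun P => h (R.toFun (fiberShift W P)) - h (R.toFun P.1) - P.2 • h' (W x₀))
      =o[zeroVectorFilter E x₀] Prod.snd :=
  isLittleO_fiberShift (S := h ∘ R.toFun)
    (hh.comp_of_eq (R.contMDiff_toFun.contMDiffAt.of_le (by simp)) (R.map_zero x₀))
    (R.hasDerivAt_comp_ray hh' (W x₀)) hW

theorem Retraction.tendsto_toFun : Tendsto R.toFun (𝓝 ⟨x₀, 0⟩) (𝓝 x₀) :=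
  (R.contMDiff_toFun.continuous.tendsto _).mono_right (congrArg 𝓝 (R.map_zero x₀)).le

end Expansion

section Transfer

variable {E : Type*} [NormedAddCommGroup E] [NormedSpace ℝ E]
  {M : Type*} [TopologicalSpace M] [ChartedSpace E M] [IsManifold 𝓘(ℝ, E) ∞ M]
  {R : Retraction E M} {x₀ : M} {W : ∀ y : M, TangentSpace 𝓘(ℝ, E) y}

theorem hasMFDerivAt_of_eventually_leftInverse {Log : M → E}
    (hLog : MDifferentiableAt 𝓘(ℝ, E) 𝓘(ℝ, E) Log x₀)
    (hleft : ∀ᶠ u : E in 𝓝 0, Log (R.at x₀ u) = u) :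
    HasMFDerivAt 𝓘(ℝ, E) 𝓘(ℝ, E) Log x₀ (ContinuousLinearMap.id ℝ E) := by
  refine hLog.hasMFDerivAt.congr_mfderiv (ContinuousLinearMap.ext fun v : E => ?_)
  have hline : Tendsto (fun t : ℝ => t • v) (𝓝 0) (𝓝 0) :=
    Continuous.tendsto' (by fun_prop) _ _ (zero_smul ℝ v)
  have hid : HasDerivAt (fun t : ℝ => t • v) v 0 := by
    simpa using (hasDerivAt_id (0 : ℝ)).smul_const v
  exact (R.hasDerivAt_comp_ray hLog.hasMFDerivAt v).unique
    (hid.congr_of_eventuallyEq (hline.eventually hleft))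

theorem exists_isLittleO_sub_pullback [CompleteSpace E] {h : M → ℝ}
    {K : NNReal} {s : Set E} (hs : s ∈ 𝓝 0) (hK : LipschitzOnWith K (fun u : E => h (R.at x₀ u)) s)
    (hW : ContinuousAt (fun y => (⟨y, W y⟩ : TangentBundle 𝓘(ℝ, E) M)) x₀) :
    ∃ ζ : TangentBundle 𝓘(ℝ, E) M × ℝ → TangentSpace 𝓘(ℝ, E) x₀,
      Tendsto ζ (zeroVectorFilter E x₀) (𝓝 0) ∧
      (fun P => (h (R.toFun (fiberShift W P)) - h (R.toFun P.1)) -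
        (h (R.at x₀ (ζ P + P.2 • W x₀)) - h (R.at x₀ (ζ P)))) =o[zeroVectorFilter E x₀]
          Prod.snd := by
  obtain ⟨Log, hLog, hLog₀, hleft, hright⟩ := R.exists_localLog x₀
  have hcont := hLog₀ ▸ hLog.continuousAt.tendsto
  have hLog' := hLog.of_le (m := 1) (by simp)
  have hexp := R.isLittleO_comp_fiberShift hLog'
    (hasMFDerivAt_of_eventually_leftInverse (hLog'.mdifferentiableAt one_ne_zero) hleft) hW
  set v : E := W x₀
  set ζ : TangentBundle 𝓘(ℝ, E) M × ℝ → E := fun P => Log (R.toFun P.1)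
  set ζ' : TangentBundle 𝓘(ℝ, E) M × ℝ → E := fun P => Log (R.toFun (fiberShift W P))
  have hbase := R.tendsto_toFun.comp (tendsto_fst_zeroVectorFilter (x₀ := x₀))
  have hshift := R.tendsto_toFun.comp (tendsto_fiberShift hW)
  have hζ : Tendsto ζ (zeroVectorFilter E x₀) (𝓝 0) := hcont.comp hbase
  have hζ' : Tendsto ζ' (zeroVectorFilter E x₀) (𝓝 0) := hcont.comp hshift
  have hline : Tendsto (fun P => ζ P + P.2 • v) (zeroVectorFilter E x₀) (𝓝 0) := by
    simpa using hζ.add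
      ((tendsto_snd_zeroVectorFilter.mono_right nhdsWithin_le_nhds).smul_const v)
  refine ⟨ζ, hζ, ?_⟩
  refine (isLittleO_comp_sub_comp_of_lipschitzOnWith hK hs hζ' hline
    (hexp.congr_left fun P => sub_sub _ _ _)).congr' ?_ .rfl
  filter_upwards [hbase.eventually hright, hshift.eventually hright] with P hP hP'
  dsimp only [Function.comp_apply] at hP hP'
  have hP₀ : h (R.at x₀ (ζ P)) = h (R.toFun P.1) := congrArg h hP
  have hP₁ : h (R.at x₀ (ζ' P)) = h (R.toFun (fiberShift W P)) := congrArg h hP'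
  rw [hP₀, hP₁]
  exact (sub_sub_sub_cancel_right _ _ _).symm

end Transfer


section LocallyLipschitz

variable {E : Type*} [NormedAddCommGroup E] [NormedSpace ℝ E]
  {M : Type*} [TopologicalSpace M] [ChartedSpace E M] [IsManifold 𝓘(ℝ, E) ∞ M]
  [Bundle.RiemannianBundle (fun x : M => TangentSpace 𝓘(ℝ, E) x)]
  {R : Retraction E M} {h : M → ℝ}

variable (E) in
/-- The identity from the model space to a tangent space, as a map between normed spaces; the
Riemannian norm on `T_x M` is only equivalent to that of `E`. -/
noncomputable def modelEquivTangentSpace (x : M) : E ≃L[ℝ] TangentSpace 𝓘(ℝ, E) x :=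
  ContinuousLinearEquiv.refl ℝ E

theorem RetractionLocallyLipschitz.comp_model (hh : RetractionLocallyLipschitz R h) (x₀ : M) :
    LocallyLipschitz (fun u : E => h (R.at x₀ u)) :=
  (hh x₀).comp (modelEquivTangentSpace E x₀).lipschitz.locallyLipschitz

theorem retractionLocallyLipschitz_of_contMDiff (hh : ContMDiff 𝓘(ℝ, E) 𝓘(ℝ, ℝ) 1 h) :
    RetractionLocallyLipschitz R h := fun x =>
  (hh.comp ((R.contMDiff_toFun.comp (contMDiff_totalSpaceMk x)).of_le
    (by simp))).contDiff.locallyLipschitz.comp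
      (modelEquivTangentSpace E x).symm.lipschitz.locallyLipschitz

theorem RetractionLocallyLipschitz.continuous [CompleteSpace E]
    (hh : RetractionLocallyLipschitz R h) : Continuous h := by
  refine continuous_iff_continuousAt.2 fun x₀ => ?_
  obtain ⟨Log, hLog, -, -, hright⟩ := R.exists_localLog x₀
  refine ContinuousAt.congr ?_ (hright.mono fun y hy => congrArg h hy)
  exact (hh.comp_model x₀).continuous.continuousAt.comp hLog.continuousAt

theorem RetractionLocallyLipschitz.add {h₁ h₂ : M → ℝ} (hh₁ : RetractionLocallyLipschitz R h₁)
    (hh₂ : RetractionLocallyLipschitz R h₂) :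
    RetractionLocallyLipschitz R (fun y => h₁ y + h₂ y) :=
  fun x => (hh₁ x).add (hh₂ x)

theorem isStationaryPoint_of_frequently [CompleteSpace E] (hh : RetractionLocallyLipschitz R h)
    {x₀ : M}
    (hfreq : ∀ W : ∀ y : M, TangentSpace 𝓘(ℝ, E) y,
      ContinuousAt (fun y => (⟨y, W y⟩ : TangentBundle 𝓘(ℝ, E) M)) x₀ →
      ∀ r > 0, ∃ᶠ P in zeroVectorFilter E x₀,
        -(r * P.2) ≤ h (R.toFun (fiberShift W P)) - h (R.toFun P.1)) :
    IsStationaryPoint R h x₀ := by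
  refine zero_mem_clarkeSubdiff_iff.2 fun v r hr => ?_
  obtain ⟨K, s, hs, hK⟩ := hh.comp_model x₀ 0
  have hW := (FiberBundle.contMDiffAt_extend (k := 0) 𝓘(ℝ, E) E v).continuousAt
  obtain ⟨ζ, hζ, herr⟩ := exists_isLittleO_sub_pullback hs hK hW
  rw [FiberBundle.extend_apply_self] at herr
  exact (hζ.prodMk tendsto_snd_zeroVectorFilter).frequently
    (frequently_neg_mul_le_of_isLittleO eventually_snd_pos_zeroVectorFilter herr (hfreq _ hW) hr)

end LocallyLipschitz

section ProxModel

variable {E : Type*} [NormedAddCommGroup E] [NormedSpace ℝ E]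
  {M : Type*} [TopologicalSpace M] [ChartedSpace E M] [IsManifold 𝓘(ℝ, E) ∞ M]
  {x₀ : M} {W : ∀ y : M, TangentSpace 𝓘(ℝ, E) y}

theorem tendsto_mfderiv_section {f : M → ℝ} (hf : ContMDiff 𝓘(ℝ, E) 𝓘(ℝ, ℝ) 1 f)
    (hW : ContinuousAt (fun y => (⟨y, W y⟩ : TangentBundle 𝓘(ℝ, E) M)) x₀) :
    Tendsto (fun y => (mfderiv 𝓘(ℝ, E) 𝓘(ℝ, ℝ) f y (W y) : ℝ)) (𝓝 x₀)
      (𝓝 (mfderiv 𝓘(ℝ, E) 𝓘(ℝ, ℝ) f x₀ (W x₀))) :=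
  have : IsManifold 𝓘(ℝ, E) 1 M := IsManifold.of_le (n := ∞) (by simp)
  have hT := (hf.continuous_tangentMap le_rfl).continuousAt.comp hW
  (continuous_snd.continuousAt.comp
    ((tangentBundleModelSpaceHomeomorph 𝓘(ℝ, ℝ)).continuous.continuousAt.comp hT)).tendsto

variable [Bundle.RiemannianBundle (fun x : M => TangentSpace 𝓘(ℝ, E) x)]

section Continuous

variable [IsContinuousRiemannianBundle E (fun x : M => TangentSpace 𝓘(ℝ, E) x)]

theorem tendsto_inner_section
    (hW : ContinuousAt (fun y => (⟨y, W y⟩ : TangentBundle 𝓘(ℝ, E) M)) x₀) :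
    Tendsto (fun P => inner ℝ P.1.2 (W P.1.proj)) (zeroVectorFilter E x₀) (𝓝 0) := by
  have hproj : ContinuousAt (fun p : TangentBundle 𝓘(ℝ, E) M => p.proj) ⟨x₀, 0⟩ :=
    (FiberBundle.continuous_proj E (TangentSpace 𝓘(ℝ, E))).continuousAt
  have hinner := ContinuousAt.inner_bundle (x := (⟨x₀, 0⟩ : TangentBundle 𝓘(ℝ, E) M))
    (b := fun p => p.proj) (v := fun p => p.2) (w := fun p => W p.proj) (F := E)
    continuousAt_id (hW.comp hproj)
  exact (hinner.tendsto.comp tendsto_fst_zeroVectorFilter).mono_right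
    (congrArg 𝓝 (inner_zero_left _)).le

theorem tendsto_norm_sq_section
    (hW : ContinuousAt (fun y => (⟨y, W y⟩ : TangentBundle 𝓘(ℝ, E) M)) x₀) :
    Tendsto (fun y => ‖W y‖ ^ 2) (𝓝 x₀) (𝓝 (‖W x₀‖ ^ 2)) := by
  simpa only [real_inner_self_eq_norm_sq] using (hW.inner_bundle (F := E) hW).tendsto

theorem tendsto_nhds_zeroVector_of_norm {α : Type*} {l : Filter α} {y : α → M}
    {η : ∀ a, TangentSpace 𝓘(ℝ, E) (y a)} (hy : Tendsto y l (𝓝 x₀))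
    (hη : Tendsto (fun a => ‖η a‖) l (𝓝 0)) :
    Tendsto (fun a => (⟨y a, η a⟩ : TangentBundle 𝓘(ℝ, E) M)) l (𝓝 ⟨x₀, 0⟩) := by
  refine tendsto_nhds_zeroVector_iff.2 ⟨hy, ?_⟩
  obtain ⟨C, -, hC⟩ :=
    eventually_norm_trivializationAt_lt E (fun x : M => TangentSpace 𝓘(ℝ, E) x) x₀
  refine squeeze_zero_norm' ?_ (by simpa using hη.const_mul C)
  filter_upwards [hy.eventually hC, hy (chart_source_mem_nhds E x₀)] with a ha hsrc
  rw [fiberCoord_mk hsrc]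
  exact (ContinuousLinearMap.le_opNorm _ _).trans
    (mul_le_mul_of_nonneg_right ha.le (norm_nonneg _))

theorem mapClusterPt_zeroVector_of_norm {α : Type*} {l : Filter α} {y : α → M}
    {η : ∀ a, TangentSpace 𝓘(ℝ, E) (y a)} (hy : MapClusterPt x₀ l y)
    (hη : Tendsto (fun a => ‖η a‖) l (𝓝 0)) :
    MapClusterPt ⟨x₀, 0⟩ l (fun a => (⟨y a, η a⟩ : TangentBundle 𝓘(ℝ, E) M)) := by
  obtain ⟨U, hU, hyU⟩ := mapClusterPt_iff_ultrafilter.1 hy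
  exact mapClusterPt_iff_ultrafilter.2
    ⟨U, hU, tendsto_nhds_zeroVector_of_norm hyU (hη.mono_left hU)⟩

end Continuous

variable [FiniteDimensional ℝ E] {R : Retraction E M} {f g : M → ℝ} {Lt : ℝ}

theorem proxModel_add_smul_sub (y : M) (ξ w : TangentSpace 𝓘(ℝ, E) y) (t : ℝ) :
    proxModel R f g Lt y (ξ + t • w) - proxModel R f g Lt y ξ =
      t * (inner ℝ (grad f y) w + Lt * inner ℝ ξ w + t * (Lt / 2 * ‖w‖ ^ 2)) +
        (g (R.at y (ξ + t • w)) - g (R.at y ξ)) := by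
  rw [proxModel, proxModel, norm_add_sq_real, inner_add_right, inner_smul_right, inner_smul_right,
    norm_smul, mul_pow, Real.norm_eq_abs, sq_abs]
  ring

variable [IsContinuousRiemannianBundle E (fun x : M => TangentSpace 𝓘(ℝ, E) x)]

theorem isLittleO_proxModel_sub (hf : ContMDiff 𝓘(ℝ, E) 𝓘(ℝ, ℝ) 1 f)
    (hW : ContinuousAt (fun y => (⟨y, W y⟩ : TangentBundle 𝓘(ℝ, E) M)) x₀) :
    (fun P => (proxModel R f g Lt P.1.proj (P.1.2 + P.2 • W P.1.proj) -
        proxModel R f g Lt P.1.proj P.1.2) -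
      ((f (R.toFun (fiberShift W P)) + g (R.toFun (fiberShift W P))) -
        (f (R.toFun P.1) + g (R.toFun P.1)))) =o[zeroVectorFilter E x₀] Prod.snd := by
  set D : ℝ := mfderiv 𝓘(ℝ, E) 𝓘(ℝ, ℝ) f x₀ (W x₀)
  have hexp : (fun P => f (R.toFun (fiberShift W P)) - f (R.toFun P.1) - P.2 • D)
      =o[zeroVectorFilter E x₀] Prod.snd :=
    R.isLittleO_comp_fiberShift hf.contMDiffAt
      (hf.mdifferentiableAt one_ne_zero).hasMFDerivAt hW
  have hquad : Tendsto (fun P : TangentBundle 𝓘(ℝ, E) M × ℝ => P.2 * (Lt / 2 * ‖W P.1.proj‖ ^ 2))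
      (zeroVectorFilter E x₀) (𝓝 0) := by
    simpa using (tendsto_snd_zeroVectorFilter.mono_right nhdsWithin_le_nhds).mul
      (((tendsto_norm_sq_section hW).comp tendsto_proj_zeroVectorFilter).const_mul (Lt / 2))
  have hslope : Tendsto (fun P : TangentBundle 𝓘(ℝ, E) M × ℝ =>
      (inner ℝ (grad f P.1.proj) (W P.1.proj) - D) + Lt * inner ℝ P.1.2 (W P.1.proj) +
        P.2 * (Lt / 2 * ‖W P.1.proj‖ ^ 2)) (zeroVectorFilter E x₀) (𝓝 0) := by
    have hgrad : Tendsto (fun y => inner ℝ (grad f y) (W y)) (𝓝 x₀) (𝓝 D) :=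
      (tendsto_mfderiv_section hf hW).congr fun y => (inner_grad f y (W y)).symm
    have hlin := (hgrad.comp (tendsto_proj_zeroVectorFilter (E := E))).sub_const D
    simpa using (hlin.add ((tendsto_inner_section hW).const_mul Lt)).add hquad
  have hslope' := (Asymptotics.isBigO_refl Prod.snd (zeroVectorFilter E x₀)).mul_isLittleO
    ((Asymptotics.isLittleO_one_iff ℝ).2 hslope)
  refine ((hslope'.congr_right fun P => mul_one P.2).sub hexp).congr_left fun P => ?_
  rw [proxModel_add_smul_sub]
  simp only [smul_eq_mul, Retraction.at, fiberShift]
  ring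

end ProxModel

section Stationarity

variable {E : Type*} [NormedAddCommGroup E] [NormedSpace ℝ E] [FiniteDimensional ℝ E]
  {M : Type*} [TopologicalSpace M] [ChartedSpace E M] [IsManifold 𝓘(ℝ, E) ∞ M]
  [Bundle.RiemannianBundle (fun x : M => TangentSpace 𝓘(ℝ, E) x)]
  [IsContinuousRiemannianBundle E (fun x : M => TangentSpace 𝓘(ℝ, E) x)]
  {R : Retraction E M} {f g : M → ℝ} {Lt : ℝ}

theorem isStationaryPoint_of_mapClusterPt (hf : ContMDiff 𝓘(ℝ, E) 𝓘(ℝ, ℝ) 1 f)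
    (hg : RetractionLocallyLipschitz R g) {α : Type*} {l : Filter α} {y : α → M}
    {η : ∀ a, TangentSpace 𝓘(ℝ, E) (y a)}
    (hstat : ∀ a, 0 ∈ clarkeSubdiff (proxModel R f g Lt (y a)) (η a))
    (hη : Tendsto (fun a => ‖η a‖) l (𝓝 0)) {x₀ : M} (hx₀ : MapClusterPt x₀ l y) :
    IsStationaryPoint R (fun z => f z + g z) x₀ := by
  have := FiniteDimensional.complete ℝ E
  refine isStationaryPoint_of_frequently ((retractionLocallyLipschitz_of_contMDiff hf).add hg)
    fun W hW r hr => frequently_neg_mul_le_of_isLittleO eventually_snd_pos_zeroVectorFilter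
      (isLittleO_proxModel_sub (Lt := Lt) hf hW) (fun s hs => ?_) hr
  refine frequently_nhds_prod_of_mapClusterPt (mapClusterPt_zeroVector_of_norm hx₀ hη) fun a => ?_
  have hincl : Tendsto (fun ξ : TangentSpace 𝓘(ℝ, E) (y a) => (⟨y a, ξ⟩ : TangentBundle 𝓘(ℝ, E) M))
      (𝓝 (η a)) (𝓝 ⟨y a, η a⟩) :=
    (FiberBundle.continuous_totalSpaceMk E (TangentSpace 𝓘(ℝ, E)) (y a)).continuousAt
  exact (hincl.prodMap tendsto_id).frequently
    (zero_mem_clarkeSubdiff_iff.1 (hstat a) (W (y a)) s hs)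

end Stationarity

section SufficientDecrease

variable {a n : ℕ → ℝ} {β m : ℝ}

theorem antitone_of_sufficient_decrease (hβ : 0 ≤ β)
    (hdec : ∀ k, a (k + 1) + β * n k ^ 2 ≤ a k) : Antitone a :=
  antitone_nat_of_succ_le fun k => (le_add_of_nonneg_right (by positivity)).trans (hdec k)

theorem exists_le_of_sufficient_decrease (hβ : 0 < β) (hdec : ∀ k, a (k + 1) + β * n k ^ 2 ≤ a k)
    (hm : ∀ k, m ≤ a k) {δ : ℝ} (hδ : 0 < δ) :
    ∃ k : ℕ, (k : ℝ) ≤ (a 0 - m) / (β * δ ^ 2) ∧ n k ≤ δ := by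
  have hpos : 0 < β * δ ^ 2 := by positivity
  set B := (a 0 - m) / (β * δ ^ 2)
  have hB : 0 ≤ B := div_nonneg (sub_nonneg.2 (hm 0)) hpos.le
  by_contra! hlarge
  have hterm : ∀ k ∈ Finset.range (⌊B⌋₊ + 1), β * δ ^ 2 ≤ a k - a (k + 1) := fun k hk => by
    have hδk : δ ≤ n k := (hlarge k <|
      (Nat.le_floor_iff hB).1 (Nat.lt_succ_iff.1 (Finset.mem_range.1 hk))).le
    have hsq : β * δ ^ 2 ≤ β * n k ^ 2 := by gcongr
    linarith [hdec k]
  have hsum : (⌊B⌋₊ + 1 : ℝ) * (β * δ ^ 2) ≤ a 0 - m := calc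
    (⌊B⌋₊ + 1 : ℝ) * (β * δ ^ 2) ≤ ∑ k ∈ Finset.range (⌊B⌋₊ + 1), (a k - a (k + 1)) := by
      simpa using Finset.card_nsmul_le_sum _ _ _ hterm
    _ = a 0 - a (⌊B⌋₊ + 1) := Finset.sum_range_sub' a _
    _ ≤ a 0 - m := sub_le_sub_left (hm _) _
  exact ((le_div_iff₀ hpos).2 hsum).not_gt (Nat.lt_floor_add_one B)

theorem tendsto_zero_of_sufficient_decrease (hβ : 0 < β)
    (hdec : ∀ k, a (k + 1) + β * n k ^ 2 ≤ a k) (hm : ∀ k, m ≤ a k) :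
    Tendsto n atTop (𝓝 0) := by
  have hlim := tendsto_atTop_ciInf (antitone_of_sufficient_decrease hβ.le hdec)
    ⟨m, forall_mem_range.2 hm⟩
  have hdiff : Tendsto (fun k => (a k - a (k + 1)) / β) atTop (𝓝 0) := by
    simpa using (hlim.sub ((tendsto_add_atTop_iff_nat 1).2 hlim)).div_const β
  have hsq : Tendsto (fun k => n k ^ 2) atTop (𝓝 0) :=
    squeeze_zero (fun k => sq_nonneg _)
      (fun k => by rw [le_div_iff₀ hβ]; linarith [hdec k]) hdiff
  rw [tendsto_zero_iff_abs_tendsto_zero]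
  simpa [Function.comp_def, Real.sqrt_sq_eq_abs] using hsq.sqrt

end SufficientDecrease

section Run

variable {E : Type*} [NormedAddCommGroup E] [NormedSpace ℝ E] [FiniteDimensional ℝ E]
  {M : Type*} [TopologicalSpace M] [ChartedSpace E M] [IsManifold 𝓘(ℝ, E) ∞ M]
  [Bundle.RiemannianBundle (fun x : M => TangentSpace 𝓘(ℝ, E) x)]
  {R : Retraction E M} {f g : M → ℝ} {L Lt : ℝ} {q : ℝ × ℝ → ℝ} {ε : ℕ → ℝ}
  {x : ℕ → M} {ηhat ηstar : ∀ k, TangentSpace 𝓘(ℝ, E) (x k)}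

theorem proxModel_zero (y : M) : proxModel R f g Lt y 0 = g y := by
  simp [proxModel, R.at_zero]

theorem IsIRPGRun.sufficient_decrease (hrun : IsIRPGRun R f g Lt q ε x ηhat ηstar) {N : Set M}
    (hxN : ∀ k, x k ∈ N) (hsmooth : RetractionSmoothOn R L f N) (k : ℕ) :
    f (x (k + 1)) + g (x (k + 1)) + (Lt - L) / 2 * ‖ηhat k‖ ^ 2 ≤ f (x k) + g (x k) := by
  have hupper := hsmooth (x k) (hxN k) {ηhat k}
    (mapsTo_singleton.2 (hrun.update k ▸ hxN (k + 1))) (ηhat k) rfl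
  have hmodel := hrun.descent k
  rw [proxModel_zero, proxModel, ← hrun.update k] at hmodel
  rw [← hrun.update k] at hupper
  linarith

theorem IsIRPGRun.tendsto_norm_ηstar (hrun : IsIRPGRun R f g Lt q ε x ηhat ηstar)
    (hhat : Tendsto (fun k => ‖ηhat k‖) atTop (𝓝 0))
    (hq : Tendsto (fun k => q (ε k, ‖ηhat k‖)) atTop (𝓝 0)) :
    Tendsto (fun k => ‖ηstar k‖) atTop (𝓝 0) :=
  squeeze_zero (fun k => norm_nonneg _)
    (fun k => (norm_le_norm_add_norm_sub (ηhat k) (ηstar k)).trans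
      (add_le_add_right (hrun.accuracy k) _)) (by simpa using hhat.add hq)

end Run

theorem isContinuousRiemannianBundle_of_isContMDiffRiemannianBundle
    {E' : Type*} [NormedAddCommGroup E'] [NormedSpace ℝ E'] {H : Type*} [TopologicalSpace H]
    (I : ModelWithCorners ℝ E' H) (n : WithTop ℕ∞)
    {B : Type*} [TopologicalSpace B] [ChartedSpace H B]
    {F : Type*} [NormedAddCommGroup F] [NormedSpace ℝ F]
    {V : B → Type*} [TopologicalSpace (Bundle.TotalSpace F V)] [∀ b, NormedAddCommGroup (V b)]
    [∀ b, InnerProductSpace ℝ (V b)] [FiberBundle F V] [VectorBundle ℝ F V]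
    [h : IsContMDiffRiemannianBundle I n F V] : IsContinuousRiemannianBundle F V :=
  let ⟨φ, hφ, hφ'⟩ := h.exists_contMDiff
  ⟨⟨φ, hφ.continuous, hφ'⟩⟩

end IRPG

theorem theorem3p1_general
    {E : Type*} [NormedAddCommGroup E] [NormedSpace ℝ E] [FiniteDimensional ℝ E]
    {M : Type*} [TopologicalSpace M] [ChartedSpace E M] [IsManifold 𝓘(ℝ, E) ∞ M]
    [Bundle.RiemannianBundle (fun x : M => TangentSpace 𝓘(ℝ, E) x)]
    [IsContinuousRiemannianBundle E (fun x : M => TangentSpace 𝓘(ℝ, E) x)]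
    (R : IRPG.Retraction E M) (f g F : M → ℝ)
    (hF : ∀ y, F y = f y + g y)
    (hf : ContMDiff 𝓘(ℝ, E) 𝓘(ℝ, ℝ) 1 f)
    (hg : IRPG.RetractionLocallyLipschitz R g)
    (L Lt : ℝ) (q : ℝ × ℝ → ℝ) (ε : ℕ → ℝ)
    (x : ℕ → M) (ηhat ηstar : ∀ k, TangentSpace 𝓘(ℝ, E) (x k))
    (hrun : IRPG.IsIRPGRun R f g Lt q ε x ηhat ηstar)
    (N : Set M) (hxN : ∀ k, x k ∈ N)
    (hsmooth : IRPG.RetractionSmoothOn R L f N)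
    (hL : L < Lt)
    (hq : Tendsto (fun k => q (ε k, ‖ηhat k‖)) atTop (𝓝 0)) :
    (IsCompact {y : M | F y ≤ F (x 0)} → ∃ xs : M, MapClusterPt xs atTop x) ∧
    ∀ xs : M, MapClusterPt xs atTop x →
      IRPG.IsStationaryPoint R F xs ∧
      ∀ δ : ℝ, 0 < δ →
        ∃ k : ℕ, (k : ℝ) ≤ (F (x 0) - F xs) / ((Lt - L) / 2 * δ ^ 2) ∧ ‖ηhat k‖ ≤ δ := by
  obtain rfl : F = fun y => f y + g y := funext hF
  have hβ : 0 < (Lt - L) / 2 := half_pos (sub_pos.2 hL)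
  have hdec := hrun.sufficient_decrease hxN hsmooth
  have hanti := IRPG.antitone_of_sufficient_decrease (a := fun k => f (x k) + g (x k)) hβ.le hdec
  refine ⟨fun hcompact => ?_, fun xs hxs => ?_⟩
  · obtain ⟨xs, -, hxs⟩ := hcompact.exists_mapClusterPt_of_frequently (l := atTop) (f := x)
      (Frequently.of_forall fun k => hanti (Nat.zero_le k))
    exact ⟨xs, hxs⟩
  · have := FiniteDimensional.complete ℝ E
    have hlower := IRPG.le_of_antitone_of_mapClusterPt
      (hf.continuous.add hg.continuous).continuousAt hanti hxs
    have hhat := IRPG.tendsto_zero_of_sufficient_decrease hβ hdec hlower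
    exact ⟨IRPG.isStationaryPoint_of_mapClusterPt hf hg hrun.stationary
      (hrun.tendsto_norm_ηstar hhat hq) hxs,
      fun δ hδ => IRPG.exists_le_of_sufficient_decrease hβ hdec hlower hδ⟩

theorem theorem3p1
    {E : Type*} [NormedAddCommGroup E] [NormedSpace ℝ E] [FiniteDimensional ℝ E]
    {M : Type*} [TopologicalSpace M] [T2Space M] [ChartedSpace E M] [IsManifold 𝓘(ℝ, E) ∞ M]
    [Bundle.RiemannianBundle (fun x : M => TangentSpace 𝓘(ℝ, E) x)]
    [IsContMDiffRiemannianBundle 𝓘(ℝ, E) ∞ E (fun x : M => TangentSpace 𝓘(ℝ, E) x)]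
    (R : IRPG.Retraction E M) (f g F : M → ℝ)
    (hF : ∀ y, F y = f y + g y)
    (hf : ContMDiff 𝓘(ℝ, E) 𝓘(ℝ, ℝ) 1 f)
    (hg : IRPG.RetractionLocallyLipschitz R g)
    (L Lt : ℝ) (q : ℝ × ℝ → ℝ) (ε : ℕ → ℝ)
    (x : ℕ → M) (ηhat ηstar : ∀ k, TangentSpace 𝓘(ℝ, E) (x k))
    (hrun : IRPG.IsIRPGRun R f g Lt q ε x ηhat ηstar)
    (hbdd : BddBelow (range F))
    (hcompact : IsCompact {y : M | F y ≤ F (x 0)})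
    (N : Set M) (hN : {y : M | F y ≤ F (x 0)} ⊆ N) (hxN : ∀ k, x k ∈ N)
    (hsmooth : IRPG.RetractionSmoothOn R L f N)
    (hL : L < Lt)
    (hq : Tendsto (fun k => q (ε k, ‖ηhat k‖)) atTop (𝓝 0)) :
    (∃ xs : M, MapClusterPt xs atTop x) ∧
    ∀ xs : M, MapClusterPt xs atTop x →
      IRPG.IsStationaryPoint R F xs ∧
      ∀ δ : ℝ, 0 < δ →
        ∃ k : ℕ, (k : ℝ) ≤ (F (x 0) - F xs) / ((Lt - L) / 2 * δ ^ 2) ∧ ‖ηhat k‖ ≤ δ := by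
  have := IRPG.isContinuousRiemannianBundle_of_isContMDiffRiemannianBundle 𝓘(ℝ, E) ∞
    (F := E) (V := fun x : M => TangentSpace 𝓘(ℝ, E) x)
  exact (theorem3p1_general R f g F hF hf hg L Lt q ε x ηhat ηstar hrun N hxN hsmooth hL
    hq).imp_left fun hex => hex hcompact
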